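/- Let $\pi$ be a finitely generated group, let $\gamma_1,\dots,\gamma_r\in\pi$, and let $\Gamma_j=\langle\gamma_j\rangle$ be the cyclic subgroups they generate. Let $G=U(N)$ with Lie algebra $\mathfrak g=\mathfrak u(N)$ (skew-Hermitian matrices), and let $\rho_0:\pi\to G$ be a homomorphism; regard $\mathfrak g$ as a $\pi$-module via $\mathrm{Ad}\circ\rho_0$. Let $C^\bullet(-,\mathfrak g)$ be the inhomogeneous group cochains with coboundary $\partial$, and let $H^2(\pi,(\Gamma_j),\mathfrak g)$ be the second cohomology of the relative complex $C^k(\pi,\mathfrak g)\oplus\bigoplus_j C^{k-1}(\Gamma_j,\mathfrak g)$ with differential $(u,(v_j)_j)\mapsto(-\partial u,\,(u|_{\Gamma_j}+\partial v_j)_j)$. Suppose $H^2(\pi,(\Gamma_j),\mathfrak g)=0$. Then for every $\eta\in\mathrm{Ker}\big[H^1(\pi,\mathfrak g)\to\bigoplus_j H^1(\Gamma_j,\mathfrak g)\big]$ there are maps $f_i:\pi\to\mathfrak g$ and elements $c_i^j\in\mathfrak g$ ($i\ge 1$, $1\le j\le r$) such that, as formal power series in $t$ with matrix coefficients: 1.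 $\rho_t(g)=\rho_0(g)\exp\big(\sum_{i\ge1}f_i(g)t^i\big)$ satisfies $\rho_t(g_1g_2)=\rho_t(g_1)\rho_t(g_2)$ for all $g_1,g_2\in\pi$; 2. for each $j$, $\rho_t(\gamma_j)=\exp\big(\sum_{i\ge1}c_i^jt^i\big)\,\rho_0(\gamma_j)\,\exp\big(-\sum_{i\ge1}c_i^jt^i\big)$, that is, $\rho_t(\gamma_j)$ stays in the conjugacy class of $\rho_0(\gamma_j)$; 3. the leading term represents $\eta$: the cochain $h_1(g)=f_1(g^{-1})$ is a $1$-cocycle of class $\eta$. -/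

import Mathlib

open CategoryTheory
open scoped PowerSeries

/-! ### Relative group cohomology of a group and a finite system of subgroups -/

noncomputable section RelativeCohomology

namespace RelativeCohomology

variable {k G : Type} [CommRing k] [Group G] (A : Rep.{0} k G) {r : ℕ}
  (Γ : Fin r → Subgroup G)

/-- The restriction of the representation `A` to the `j`-th subgroup. -/
abbrev resTo (j : Fin r) : Rep.{0} k (Γ j) := Rep.res (Γ j).subtype A

/-- Relative `1`-cochains, `C¹(G, A) ⊕ ⨁ⱼ C⁰(Γⱼ, A)`. -/
abbrev C1 : Type := (G → A) × (∀ j, resTo A Γ j)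

/-- Relative `2`-cochains, `C²(G, A) ⊕ ⨁ⱼ C¹(Γⱼ, A)`. -/
abbrev C2 : Type := (G × G → A) × (∀ j, Γ j → resTo A Γ j)

/-- Relative `3`-cochains, `C³(G, A) ⊕ ⨁ⱼ C²(Γⱼ, A)`. -/
abbrev C3 : Type := (G × G × G → A) × (∀ j, Γ j × Γ j → resTo A Γ j)

/-- Restriction of `1`-cochains `C¹(G, A) → C¹(Γⱼ, A)`. -/
abbrev R1 (j : Fin r) : (G → A) →ₗ[k] (Γ j → resTo A Γ j) :=
  (groupCohomology.cochainsMap₁ (Γ j).subtype (𝟙 (resTo A Γ j))).hom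

/-- Restriction of `2`-cochains `C²(G, A) → C²(Γⱼ, A)`. -/
abbrev R2 (j : Fin r) : (G × G → A) →ₗ[k] (Γ j × Γ j → resTo A Γ j) :=
  (groupCohomology.cochainsMap₂ (Γ j).subtype (𝟙 (resTo A Γ j))).hom

/-- The differential of the cone of the restriction maps, in degree `1`:
`(h, c) ↦ (-∂h, (Rⱼ h + ∂ cⱼ)ⱼ)`. -/
def d12 : C1 A Γ →ₗ[k] C2 A Γ :=
  LinearMap.prod
    (-((groupCohomology.d₁₂ A).hom ∘ₗ LinearMap.fst k _ _))
    (LinearMap.pi fun j =>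
      R1 A Γ j ∘ₗ LinearMap.fst k _ _ +
        (groupCohomology.d₀₁ (resTo A Γ j)).hom ∘ₗ LinearMap.proj j ∘ₗ LinearMap.snd k _ _)

/-- The differential of the cone of the restriction maps, in degree `2`:
`(o, b) ↦ (-∂o, (Rⱼ o + ∂ bⱼ)ⱼ)`. -/
def d23 : C2 A Γ →ₗ[k] C3 A Γ :=
  LinearMap.prod
    (-((groupCohomology.d₂₃ A).hom ∘ₗ LinearMap.fst k _ _))
    (LinearMap.pi fun j =>
      R2 A Γ j ∘ₗ LinearMap.fst k _ _ +
        (groupCohomology.d₁₂ (resTo A Γ j)).hom ∘ₗ LinearMap.proj j ∘ₗ LinearMap.snd k _ _)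

theorem d12_apply (x : C1 A Γ) :
    d12 A Γ x = (fun g : G × G => -(A.ρ g.1 (x.1 g.2) - x.1 (g.1 * g.2) + x.1 g.1),
      fun j (s : Γ j) => x.1 s + (A.ρ s (x.2 j) - x.2 j)) := rfl

theorem d23_apply (x : C2 A Γ) :
    d23 A Γ x = (fun g : G × G × G => -(A.ρ g.1 (x.1 (g.2.1, g.2.2)) - x.1 (g.1 * g.2.1, g.2.2)
        + x.1 (g.1, g.2.1 * g.2.2) - x.1 (g.1, g.2.1)),
      fun j (s : Γ j × Γ j) => x.1 (s.1, s.2) + (A.ρ s.1 (x.2 j s.2) - x.2 j (s.1 * s.2) + x.2 j s.1)) := rfl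

theorem d23_d12 (x : C1 A Γ) : d23 A Γ (d12 A Γ x) = 0 := by
  rw [d23_apply, d12_apply]
  refine Prod.ext (funext fun g => ?_) (funext fun j => funext fun s => ?_)
  · simp [mul_assoc]
    abel
  · simp
    abel

/-- The second relative cohomology group `H²(G, (Γⱼ), A)`: relative `2`-cocycles modulo
relative `2`-coboundaries. -/
abbrev H2 : Type :=
  LinearMap.ker (d23 A Γ) ⧸ (LinearMap.range (d12 A Γ)).submoduleOf (LinearMap.ker (d23 A Γ))

/-- The parabolic cohomology `Ker[H¹(G, A) → ⨁ⱼ H¹(Γⱼ, A)]`. -/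
def parabolicH1 : Submodule k (groupCohomology.H1 A) :=
  ⨅ j, LinearMap.ker (groupCohomology.map (Γ j).subtype (𝟙 (resTo A Γ j)) 1).hom

end RelativeCohomology

end RelativeCohomology

/-! ### Formal deformations of unitary representations -/

noncomputable section FormalDeformations

namespace FormalDeformations

/-- The Lie algebra `𝔲(N)` of skew-Hermitian matrices, as a real vector space. -/
abbrev uLie (N : ℕ) : Submodule ℝ (Matrix (Fin N) (Fin N) ℂ) :=
  skewAdjoint.submodule ℝ (Matrix (Fin N) (Fin N) ℂ)

/-- The adjoint representation of `U(N)` on `𝔲(N)`, `Ad(u) x = u x u⁻¹`. -/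
def Ad (N : ℕ) : Representation ℝ (Matrix.unitaryGroup (Fin N) ℂ) (uLie N) where
  toFun u :=
    { toFun := fun x =>
        ⟨(u : Matrix (Fin N) (Fin N) ℂ) * x * ((u⁻¹ : Matrix.unitaryGroup (Fin N) ℂ) :
          Matrix (Fin N) (Fin N) ℂ), skewAdjoint.conjugate x.2 _⟩
      map_add' := fun x y => Subtype.ext (by simp [mul_add, add_mul])
      map_smul' := fun c x => Subtype.ext (by simp) }
  map_one' := by ext1 x; exact Subtype.ext (by simp)
  map_mul' u v := by ext1 x; exact Subtype.ext (by simp [mul_assoc])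

variable {π : Type} [Group π] {N : ℕ}

/-- `𝔤 = 𝔲(N)` as a `π`-module through `Ad ∘ ρ₀`. -/
abbrev adRep (ρ₀ : π →* Matrix.unitaryGroup (Fin N) ℂ) : Rep.{0} ℝ π :=
  Rep.of ((Ad N).comp ρ₀)

/-- The formal power series `∑_{i ≥ 1} aᵢ tⁱ` with coefficients in `𝔲(N)`, as a power series
with matrix coefficients (`a 0` is not used). -/
def lieSeries (a : ℕ → uLie N) : (Matrix (Fin N) (Fin N) ℂ)⟦X⟧ :=
  PowerSeries.mk fun i => if i = 0 then 0 else (a i : Matrix (Fin N) (Fin N) ℂ)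

/-- The exponential `∑ₘ xᵐ / m!` of a power series `x` without constant term; as `xᵐ` is then
divisible by `tᵐ`, only the terms with `m ≤ n` contribute to the coefficient of `tⁿ`. -/
def formalExp (x : (Matrix (Fin N) (Fin N) ℂ)⟦X⟧) : (Matrix (Fin N) (Fin N) ℂ)⟦X⟧ :=
  PowerSeries.mk fun n =>
    ∑ m ∈ Finset.range (n + 1), ((m.factorial : ℂ)⁻¹) • PowerSeries.coeff n (x ^ m)

/-- A formal power series deformation of `ρ₀ : π → U(N)`: a homomorphism
`ρ_t(g) = ρ₀(g) exp(∑_{i ≥ 1} fᵢ(g) tⁱ)` with `fᵢ : π → 𝔲(N)`. -/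
structure FormalDeformation (ρ₀ : π →* Matrix.unitaryGroup (Fin N) ℂ) where
  /-- the homomorphism `ρ_t` -/
  toHom : π →* (Matrix (Fin N) (Fin N) ℂ)⟦X⟧
  /-- the cochains `fᵢ`, `i ≥ 1` -/
  f : ℕ → π → uLie N
  toHom_eq : ∀ g, toHom g =
    PowerSeries.C (ρ₀ g : Matrix (Fin N) (Fin N) ℂ) * formalExp (lieSeries fun i => f i g)

/-- Along `ρ_t` the element `γ` stays in the conjugacy class of `ρ₀(γ)`:
`ρ_t(γ) = exp(∑_{i ≥ 1} cᵢ tⁱ) ρ₀(γ) exp(-∑_{i ≥ 1} cᵢ tⁱ)` for some `cᵢ ∈ 𝔲(N)`. -/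
def FormalDeformation.FixesConjClass {ρ₀ : π →* Matrix.unitaryGroup (Fin N) ℂ}
    (ρt : FormalDeformation ρ₀) (γ : π) : Prop :=
  ∃ c : ℕ → uLie N, ρt.toHom γ =
    formalExp (lieSeries c) * PowerSeries.C (ρ₀ γ : Matrix (Fin N) (Fin N) ℂ) *
      formalExp (-lieSeries c)

/-- The leading term of `ρ_t` represents `η ∈ H¹(π, 𝔤)`: the `1`-cochain
`h₁(g) = f₁(g⁻¹)` is a cocycle of class `η`. -/
def FormalDeformation.Represents {ρ₀ : π →* Matrix.unitaryGroup (Fin N) ℂ}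
    (ρt : FormalDeformation ρ₀) (η : groupCohomology.H1 (adRep ρ₀)) : Prop :=
  ∃ z : groupCohomology.cocycles₁ (adRep ρ₀),
    (∀ g, z g = ρt.f 1 g⁻¹) ∧ groupCohomology.H1π (adRep ρ₀) z = η

end FormalDeformations

end FormalDeformations

/-!
Everything takes place in the group `U` of unitary elements of `M⟦X⟧`, where `M` is the ring of
complex `N × N` matrices and the involution of `M⟦X⟧` is coefficientwise. `U` is filtered by the
normal subgroups `U_m` of series congruent to `1` modulo `X ^ m`. For `m ≥ 1`, sending
`1 + a X ^ m + ⋯` to `a` identifies `U_m / U_{m+1}` with `𝔲(N)`, and conjugation by a series with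
constant term `u` acts there as `Ad u` (`HasLeadingTerm`). The filtration is complete
(`exists_limit`), and `U_1` consists of the exponentials of series of skew-Hermitian matrices
(`exists_formalExp_eq`). Thus it is enough to find a homomorphism `P : π → U` lifting `ρ₀` and
`Lⱼ ∈ U_1` with `P = Lⱼ ρ₀ Lⱼ⁻¹` on all of `Γⱼ`.

These are built order by order, from maps `ρ` and elements `Kⱼ` having the two properties modulo
`X ^ m`. Write `ρ(g₁) ρ(g₂) = (1 + o(g₁, g₂) X ^ m + ⋯) ρ(g₁ g₂)` and, for `s` in `Γⱼ`,
`ρ(s) = (1 + eⱼ(s) X ^ m + ⋯) Kⱼ ρ₀(s) Kⱼ⁻¹`. Associativity gives `∂o = 0` and restriction to `Γⱼ`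
gives `o = ∂eⱼ`, so `(o, -e)` is a relative `2`-cocycle, hence the relative coboundary of some
`(h, c)`. Multiplying `ρ` by `1 + h X ^ m + ⋯` and `Kⱼ` by `1 + cⱼ X ^ m + ⋯` replaces `o` by
`o + ∂h = 0` and `eⱼ` by `eⱼ + h + ∂cⱼ = 0`, so the properties hold modulo `X ^ (m + 1)`
(`IsDeformationMod.exists_update`, `IsDeformationMod.exists_next`).

The first step is the same update, applied to `ρ₀` itself with `h = -z` for a cocycle `z` of class
`η`, and `cⱼ` with `z = ∂cⱼ` on `Γⱼ`, which exists as `η` restricts to zero. The sign is that of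
`f₁(g⁻¹)`: the leading coefficient of `ρ₀(g) P(g⁻¹) = (P(g) ρ₀(g)⁻¹)⁻¹` is `z(g)`.
-/

/-! ### The star ring of formal power series -/

namespace PowerSeries

section Ring

variable {A : Type*} [Ring A]

/-- In a noncommutative ring divisibility by `X ^ m` is still a two-sided condition. -/
theorem X_pow_dvd_mul_right {m : ℕ} {p : A⟦X⟧} (h : X ^ m ∣ p) (q : A⟦X⟧) : X ^ m ∣ q * p := by
  obtain ⟨r, rfl⟩ := h
  exact ⟨q * r, by rw [← mul_assoc, ← X_pow_mul, mul_assoc]⟩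

theorem X_pow_dvd_mul_sub_mul {m : ℕ} {p p' q q' : A⟦X⟧} (hp : X ^ m ∣ p - p')
    (hq : X ^ m ∣ q - q') : X ^ m ∣ p * q - p' * q' := by
  have h : p * q - p' * q' = p * (q - q') + (p - p') * q' := by noncomm_ring
  rw [h]
  exact dvd_add (X_pow_dvd_mul_right hq _) (dvd_mul_of_dvd_left hp _)

theorem X_pow_mul_mul_X_pow_mul (m : ℕ) (p q : A⟦X⟧) :
    X ^ m * p * (X ^ m * q) = X ^ m * (X ^ m * (p * q)) := by
  rw [mul_assoc, ← mul_assoc p, ← X_pow_mul, mul_assoc]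

theorem eq_of_forall_X_pow_dvd_sub {p q : A⟦X⟧} (h : ∀ n, X ^ n ∣ p - q) : p = q := by
  ext n
  simpa [sub_eq_zero] using X_pow_dvd_iff.1 (h (n + 1)) n n.lt_succ_self

end Ring

section Star

variable {A : Type*} [Ring A] [StarRing A]

/-- The coefficientwise involution on formal power series; the variable is self-adjoint. -/
noncomputable instance instStarRingOfCoeff : StarRing A⟦X⟧ where
  star p := mk fun n => star (coeff n p)
  star_involutive p := by ext n; simp
  star_mul p q := by
    ext n
    simp only [coeff_mk, coeff_mul, star_sum, star_mul]
    exact Finset.Nat.sum_antidiagonal_swap (f := fun x => star (coeff x.1 q) * star (coeff x.2 p))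
  star_add p q := by ext n; simp

@[simp]
theorem coeff_star (n : ℕ) (p : A⟦X⟧) : coeff n (star p) = star (coeff n p) :=
  coeff_mk _ _

@[simp]
theorem constantCoeff_star (p : A⟦X⟧) : constantCoeff (star p) = star (constantCoeff p) := by
  rw [← coeff_zero_eq_constantCoeff_apply, coeff_star, coeff_zero_eq_constantCoeff_apply]

@[simp]
theorem star_X : star (X : A⟦X⟧) = X := by
  ext n
  rw [coeff_star, coeff_X]
  split_ifs <;> simp

@[simp]
theorem star_C (a : A) : star (C a) = C (star a) := by
  ext n
  rw [coeff_star, coeff_C, coeff_C]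
  split_ifs <;> simp

theorem star_X_pow_mul (m : ℕ) (p : A⟦X⟧) : star (X ^ m * p) = X ^ m * star p := by
  rw [star_mul, star_pow, star_X, X_pow_mul]

theorem X_pow_dvd_star_sub_star {m : ℕ} {p p' : A⟦X⟧} (hp : X ^ m ∣ p - p') :
    X ^ m ∣ star p - star p' := by
  obtain ⟨r, hr⟩ := hp
  exact ⟨star r, by rw [← star_sub, hr, star_X_pow_mul]⟩

end Star

end PowerSeries

namespace FormalDeformations

open PowerSeries

/-! ### The congruence filtration on unitary power series -/

section Unitary

variable {A : Type*} [Ring A] [StarRing A]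

/-- The unitary power series congruent to `1` modulo `X ^ m`, a normal subgroup. -/
def congruenceSubgroup (A : Type*) [Ring A] [StarRing A] (m : ℕ) :
    Subgroup (unitary A⟦X⟧) where
  carrier := {u | X ^ m ∣ (u : A⟦X⟧) - 1}
  one_mem' := by simp
  mul_mem' {u v} hu hv := by
    have := X_pow_dvd_mul_sub_mul hu hv
    rwa [one_mul] at this
  inv_mem' {u} hu := by
    have := X_pow_dvd_star_sub_star hu
    rwa [star_one] at this

theorem mem_congruenceSubgroup {m : ℕ} {u : unitary A⟦X⟧} :
    u ∈ congruenceSubgroup A m ↔ X ^ m ∣ (u : A⟦X⟧) - 1 := Iff.rfl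

instance (m : ℕ) : (congruenceSubgroup A m).Normal where
  conj_mem u hu e := by
    obtain ⟨q, hq⟩ := mem_congruenceSubgroup.1 hu
    have h1 : (e : A⟦X⟧) * star (e : A⟦X⟧) = 1 := Unitary.mul_star_self_of_mem e.2
    refine mem_congruenceSubgroup.2 ⟨e * q * star (e : A⟦X⟧), ?_⟩
    calc (e : A⟦X⟧) * u * star (e : A⟦X⟧) - 1
        = e * (u - 1) * star (e : A⟦X⟧) := by rw [mul_sub, sub_mul, mul_one, h1]
      _ = _ := by rw [hq, ← mul_assoc, ← X_pow_mul]; simp only [mul_assoc]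

theorem congruenceSubgroup_anti : Antitone (congruenceSubgroup A) :=
  fun _ _ h _ hu => (pow_dvd_pow X h).trans hu

theorem mul_inv_mem_congruenceSubgroup {m : ℕ} {u v : unitary A⟦X⟧} :
    u * v⁻¹ ∈ congruenceSubgroup A m ↔ X ^ m ∣ (u : A⟦X⟧) - (v : A⟦X⟧) := by
  have h1 : star (v : A⟦X⟧) * v = 1 := Unitary.star_mul_self_of_mem v.2
  have h2 : (v : A⟦X⟧) * star (v : A⟦X⟧) = 1 := Unitary.mul_star_self_of_mem v.2
  rw [mem_congruenceSubgroup]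
  change X ^ m ∣ (u : A⟦X⟧) * star (v : A⟦X⟧) - 1 ↔ _
  constructor
  · intro h
    have := dvd_mul_of_dvd_left h (v : A⟦X⟧)
    rwa [sub_mul, mul_assoc, h1, mul_one, one_mul] at this
  · intro h
    have := dvd_mul_of_dvd_left h (star (v : A⟦X⟧))
    rwa [sub_mul, h2] at this

theorem eq_of_forall_mul_inv_mem {u v : unitary A⟦X⟧}
    (h : ∀ m, u * v⁻¹ ∈ congruenceSubgroup A m) : u = v :=
  Subtype.ext <| eq_of_forall_X_pow_dvd_sub fun m => mul_inv_mem_congruenceSubgroup.1 (h m)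

/-- The group of unitary power series is complete for the congruence filtration. -/
theorem exists_limit (m : ℕ) (u : ℕ → unitary A⟦X⟧)
    (hu : ∀ n, u (n + 1) * (u n)⁻¹ ∈ congruenceSubgroup A (m + n)) :
    ∃ v : unitary A⟦X⟧, ∀ n, v * (u n)⁻¹ ∈ congruenceSubgroup A (m + n) := by
  have hstep : ∀ n k, X ^ (m + n) ∣ (u (n + k) : A⟦X⟧) - (u n : A⟦X⟧) := by
    intro n k
    induction k with
    | zero => simp
    | succ k ih =>
      have h := (pow_dvd_pow X (show m + n ≤ m + (n + k) by omega)).trans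
        (mul_inv_mem_congruenceSubgroup.1 (hu (n + k)))
      have := dvd_add h ih
      rwa [sub_add_sub_cancel] at this
  -- The `n`-th coefficient is stable from index `n + 1` on.
  set v : A⟦X⟧ := mk fun n => coeff n (u (n + 1) : A⟦X⟧) with hv
  have hvu : ∀ n, X ^ (m + n) ∣ v - (u n : A⟦X⟧) := by
    refine fun n => X_pow_dvd_iff.2 fun i hi => ?_
    rw [map_sub, sub_eq_zero, hv, coeff_mk]
    rcases le_total (i + 1) n with h | h <;> obtain ⟨k, hk⟩ := Nat.exists_eq_add_of_le h
    · have := X_pow_dvd_iff.1 (hstep (i + 1) k) i (by omega)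
      rw [map_sub, sub_eq_zero] at this
      rw [hk, this]
    · have := X_pow_dvd_iff.1 (hstep n k) i hi
      rw [map_sub, sub_eq_zero] at this
      rw [hk, this]
  have hmem : v ∈ unitary A⟦X⟧ := by
    refine Unitary.mem_iff.2 ⟨?_, ?_⟩ <;>
    refine eq_of_forall_X_pow_dvd_sub fun n => (pow_dvd_pow X (Nat.le_add_left n m)).trans ?_
    · rw [← Unitary.star_mul_self_of_mem (u n).2]
      exact X_pow_dvd_mul_sub_mul (X_pow_dvd_star_sub_star (hvu n)) (hvu n)
    · rw [← Unitary.mul_star_self_of_mem (u n).2]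
      exact X_pow_dvd_mul_sub_mul (hvu n) (X_pow_dvd_star_sub_star (hvu n))
  exact ⟨⟨v, hmem⟩, fun n => mul_inv_mem_congruenceSubgroup.2 (hvu n)⟩

/-- The unitary power series `u` has the form `1 + a X ^ m + ⋯`. For `m ≥ 1` such leading
coefficients add under multiplication, which identifies the successive quotients of the congruence
filtration with the skew-adjoint elements. -/
def HasLeadingTerm (m : ℕ) (u : unitary A⟦X⟧) (a : A) : Prop :=
  ∃ q : A⟦X⟧, (u : A⟦X⟧) = 1 + X ^ m * q ∧ constantCoeff q = a

namespace HasLeadingTerm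

variable {m : ℕ} {u v : unitary A⟦X⟧} {a b : A}

theorem coeff_eq (hm : 1 ≤ m) (h : HasLeadingTerm m u a) : coeff m (u : A⟦X⟧) = a := by
  obtain ⟨q, hq, rfl⟩ := h
  have h0 : m ≠ 0 := by omega
  simp [hq, coeff_one, h0, coeff_X_pow_mul']

theorem unique (ha : HasLeadingTerm m u a) (hb : HasLeadingTerm m u b) : a = b := by
  obtain ⟨p, hp, rfl⟩ := ha
  obtain ⟨q, hq, rfl⟩ := hb
  rw [hp] at hq
  rw [X_pow_mul_cancel (add_left_cancel hq)]

theorem one : HasLeadingTerm m (1 : unitary A⟦X⟧) 0 := ⟨0, by simp, by simp⟩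

theorem mul (hm : 1 ≤ m) (hu : HasLeadingTerm m u a) (hv : HasLeadingTerm m v b) :
    HasLeadingTerm m (u * v) (a + b) := by
  obtain ⟨p, hp, rfl⟩ := hu
  obtain ⟨q, hq, rfl⟩ := hv
  have h0 : m ≠ 0 := by omega
  refine ⟨p + q + X ^ m * (p * q), ?_, by simp [h0]⟩
  rw [Submonoid.coe_mul, hp, hq, mul_add, mul_add, ← X_pow_mul_mul_X_pow_mul]
  noncomm_ring

theorem star_eq_neg (hm : 1 ≤ m) (hu : HasLeadingTerm m u a) : star a = -a := by
  obtain ⟨q, hq, rfl⟩ := hu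
  have h0 : m ≠ 0 := by omega
  have h := Unitary.star_mul_self_of_mem u.2
  rw [hq, star_add, star_one, star_X_pow_mul] at h
  have h2 : X ^ m * (star q + q + X ^ m * (star q * q)) = X ^ m * 0 := by
    rw [mul_add, mul_add, ← X_pow_mul_mul_X_pow_mul, mul_zero]
    calc _ = (1 + X ^ m * star q) * (1 + X ^ m * q) - 1 := by noncomm_ring
      _ = 0 := by rw [h, sub_self]
  have h3 := congrArg constantCoeff (X_pow_mul_cancel h2)
  simp only [map_add, map_mul, map_pow, constantCoeff_X, zero_pow h0, zero_mul, add_zero,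
    map_zero, constantCoeff_star] at h3
  exact eq_neg_of_add_eq_zero_left h3

theorem inv (hm : 1 ≤ m) (hu : HasLeadingTerm m u a) : HasLeadingTerm m u⁻¹ (-a) := by
  rw [← hu.star_eq_neg hm]
  obtain ⟨q, hq, rfl⟩ := hu
  refine ⟨star q, ?_, by simp⟩
  change star (u : A⟦X⟧) = _
  rw [hq, star_add, star_one, star_X_pow_mul]

theorem conj (hu : HasLeadingTerm m u a) (e : unitary A⟦X⟧) :
    HasLeadingTerm m (e * u * e⁻¹)
      (constantCoeff (e : A⟦X⟧) * a * star (constantCoeff (e : A⟦X⟧))) := by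
  obtain ⟨q, hq, rfl⟩ := hu
  have h1 : (e : A⟦X⟧) * star (e : A⟦X⟧) = 1 := Unitary.mul_star_self_of_mem e.2
  refine ⟨e * q * star (e : A⟦X⟧), ?_, by simp⟩
  change (e : A⟦X⟧) * u * star (e : A⟦X⟧) = _
  rw [hq, mul_add, add_mul, mul_one, h1, ← mul_assoc, ← X_pow_mul]
  simp only [mul_assoc]

theorem mem (hu : HasLeadingTerm m u a) : u ∈ congruenceSubgroup A m := by
  obtain ⟨q, hq, -⟩ := hu
  exact mem_congruenceSubgroup.2 ⟨q, by rw [hq, add_sub_cancel_left]⟩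

theorem exists_of_mem (hu : u ∈ congruenceSubgroup A m) : ∃ a, HasLeadingTerm m u a := by
  obtain ⟨q, hq⟩ := mem_congruenceSubgroup.1 hu
  exact ⟨_, q, by rw [← hq, add_sub_cancel], rfl⟩

theorem zero_iff : HasLeadingTerm m u 0 ↔ u ∈ congruenceSubgroup A (m + 1) := by
  rw [mem_congruenceSubgroup]
  constructor
  · rintro ⟨q, hq, h0⟩
    obtain ⟨r, rfl⟩ := X_dvd_iff.2 h0
    exact ⟨r, by rw [hq, add_sub_cancel_left, pow_succ, mul_assoc]⟩
  · rintro ⟨q, hq⟩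
    exact ⟨X * q, by rw [← mul_assoc, ← pow_succ, ← hq, add_sub_cancel], by simp⟩

end HasLeadingTerm

/-- The constant unitary power series. -/
noncomputable def constUnitary (A : Type*) [Ring A] [StarRing A] : unitary A →* unitary A⟦X⟧ where
  toFun u := ⟨C (u : A), Unitary.mem_iff.2
    ⟨by rw [star_C, ← map_mul, Unitary.star_mul_self_of_mem u.2, map_one],
      by rw [star_C, ← map_mul, Unitary.mul_star_self_of_mem u.2, map_one]⟩⟩
  map_one' := Subtype.ext (by simp)
  map_mul' u v := Subtype.ext (by simp)

@[simp]
theorem coe_constUnitary (u : unitary A) : (constUnitary A u : A⟦X⟧) = C (u : A) := rfl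

/-- The constant term of a unitary power series only depends on its class modulo `X`. -/
theorem constantCoeff_eq_of_mul_inv_mem {m : ℕ} (hm : 1 ≤ m) {u v : unitary A⟦X⟧}
    (h : u * v⁻¹ ∈ congruenceSubgroup A m) :
    constantCoeff (u : A⟦X⟧) = constantCoeff (v : A⟦X⟧) := by
  have := X_pow_dvd_iff.1 (mul_inv_mem_congruenceSubgroup.1 h) 0 hm
  simpa [sub_eq_zero] using this

end Unitary

/-! ### The formal exponential and logarithm -/

section Exp

variable {N : ℕ} {x y : (Matrix (Fin N) (Fin N) ℂ)⟦X⟧}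

theorem coeff_complex_smul (n : ℕ) (c : ℂ) (p : (Matrix (Fin N) (Fin N) ℂ)⟦X⟧) :
    coeff n (c • p) = c • coeff n p := rfl

theorem X_pow_dvd_pow (hx : X ∣ x) (m : ℕ) : X ^ m ∣ x ^ m := by
  obtain ⟨y, rfl⟩ := hx
  exact ⟨y ^ m, ((commute_X y).symm).mul_pow m⟩

theorem coeff_formalExp (hx : X ∣ x) {n M : ℕ} (h : n < M) :
    coeff n (formalExp x) = coeff n (∑ m ∈ Finset.range M, ((m.factorial : ℂ)⁻¹) • x ^ m) := by
  rw [formalExp, coeff_mk, map_sum]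
  refine Finset.sum_subset (Finset.range_mono h) fun m _ hm => ?_
  rw [X_pow_dvd_iff.1 (X_pow_dvd_pow hx m) n (by simpa using hm), smul_zero]

theorem formalExp_mul_neg (hx : X ∣ x) : formalExp x * formalExp (-x) = 1 := by
  have hx' : X ∣ -x := (dvd_neg).2 hx
  ext1 n
  have h1 : coeff n (formalExp x * formalExp (-x)) =
      coeff n ((∑ m ∈ Finset.range (n + 1), ((m.factorial : ℂ)⁻¹) • x ^ m) *
        ∑ m ∈ Finset.range (n + 1), ((m.factorial : ℂ)⁻¹) • (-x) ^ m) := by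
    rw [coeff_mul, coeff_mul]
    refine Finset.sum_congr rfl fun p hp => ?_
    have hp := Finset.HasAntidiagonal.mem_antidiagonal.1 hp
    rw [coeff_formalExp hx (show p.1 < n + 1 by omega),
      coeff_formalExp hx' (show p.2 < n + 1 by omega)]
  let F : ℕ → ℕ → (Matrix (Fin N) (Fin N) ℂ)⟦X⟧ := fun a b =>
    (((a.factorial : ℂ)⁻¹) • x ^ a) * (((b.factorial : ℂ)⁻¹) • (-x) ^ b)
  -- Terms of total degree above `n` do not contribute, so the product of partial sums may be
  -- replaced by a sum over the antidiagonals of degree at most `n`.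
  have h2 : coeff n ((∑ m ∈ Finset.range (n + 1), ((m.factorial : ℂ)⁻¹) • x ^ m) *
        ∑ m ∈ Finset.range (n + 1), ((m.factorial : ℂ)⁻¹) • (-x) ^ m) =
      coeff n (∑ m ∈ Finset.range (n + 1), ∑ k ∈ Finset.range (m + 1), F k (m - k)) := by
    rw [Finset.sum_range_diag_flip, Finset.sum_mul, map_sum, map_sum]
    refine Finset.sum_congr rfl fun a _ => ?_
    rw [Finset.mul_sum, map_sum, map_sum]
    refine (Finset.sum_subset (Finset.range_mono (Nat.sub_le _ _)) fun b _ hb => ?_).symm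
    have hd : X ^ (a + b) ∣ x ^ a * (-x) ^ b := by
      obtain ⟨p, hp⟩ := X_pow_dvd_pow hx a
      obtain ⟨q, hq⟩ := X_pow_dvd_pow hx' b
      refine ⟨p * q, ?_⟩
      rw [hp, hq, pow_add, mul_assoc, ← mul_assoc p, ← X_pow_mul]
      simp only [mul_assoc]
    have hb : n < a + b := by
      have : ¬ b < n + 1 - a := by simpa using hb
      omega
    rw [smul_mul_smul_comm]
    rw [coeff_complex_smul, X_pow_dvd_iff.1 hd n hb, smul_zero]
  have h3 : ∀ m, ∑ k ∈ Finset.range (m + 1), F k (m - k) =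
      ((m.factorial : ℂ)⁻¹) • (x + -x) ^ m := by
    intro m
    rw [((Commute.refl x).neg_right).add_pow, Finset.smul_sum]
    refine Finset.sum_congr rfl fun k hk => ?_
    have hk : k ≤ m := by simpa [Nat.lt_succ_iff] using hk
    have hc : ((k.factorial : ℂ)⁻¹) * (((m - k).factorial : ℂ)⁻¹) =
        (m.factorial : ℂ)⁻¹ * (m.choose k : ℂ) := by
      rw [Nat.cast_choose ℂ hk]
      have := Nat.cast_ne_zero (R := ℂ).2 m.factorial_ne_zero
      field_simp
    simp only [F]
    rw [smul_mul_smul_comm, hc, mul_smul, Nat.cast_smul_eq_nsmul, nsmul_eq_mul,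
      (Nat.cast_commute (m.choose k) _).eq]
  rw [h1, h2, Finset.sum_congr rfl fun m _ => h3 m, add_neg_cancel,
    Finset.sum_eq_single 0 (fun m _ hm => by rw [zero_pow hm, smul_zero]) (by simp)]
  simp

theorem star_formalExp (x : (Matrix (Fin N) (Fin N) ℂ)⟦X⟧) :
    star (formalExp x) = formalExp (star x) := by
  ext1 n
  rw [coeff_star, formalExp, formalExp, coeff_mk, coeff_mk, star_sum]
  refine Finset.sum_congr rfl fun m _ => ?_
  rw [star_smul, ← coeff_star, star_pow]
  simp

/-- The `n`-th coefficient of `exp x` is that of `x` plus a term depending only on the lower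
coefficients of `x`. -/
theorem coeff_formalExp_sub {n : ℕ} (hn : 1 ≤ n) (hx : X ∣ x) (hy : X ∣ y) (h : X ^ n ∣ x - y) :
    coeff n (formalExp x) - coeff n (formalExp y) = coeff n x - coeff n y := by
  have hpow : ∀ m, X ^ (n + 1) ∣ x ^ (m + 2) - y ^ (m + 2) := by
    have key : ∀ a b : (Matrix (Fin N) (Fin N) ℂ)⟦X⟧, X ∣ a → X ^ n ∣ b → X ^ (n + 1) ∣ a * b := by
      rintro _ _ ⟨a, rfl⟩ ⟨b, rfl⟩
      refine ⟨a * b, ?_⟩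
      rw [pow_succ', mul_assoc, ← mul_assoc a, ← X_pow_mul]
      simp only [mul_assoc]
    have key' : ∀ a b : (Matrix (Fin N) (Fin N) ℂ)⟦X⟧, X ^ n ∣ a → X ∣ b → X ^ (n + 1) ∣ a * b := by
      rintro _ _ ⟨a, rfl⟩ ⟨b, rfl⟩
      refine ⟨a * b, ?_⟩
      rw [pow_succ, mul_assoc, ← mul_assoc a, ← X_mul]
      simp only [mul_assoc]
    intro m
    induction m with
    | zero =>
      have e : x ^ (0 + 2) - y ^ (0 + 2) = x * (x - y) + (x - y) * y := by noncomm_ring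
      rw [e]
      exact dvd_add (key _ _ hx h) (key' _ _ h hy)
    | succ m ih =>
      have e : x ^ (m + 1 + 2) - y ^ (m + 1 + 2) =
          x ^ (m + 2) * (x - y) + (x ^ (m + 2) - y ^ (m + 2)) * y := by
        rw [pow_succ x, pow_succ y, mul_sub, sub_mul]
        abel
      rw [e]
      refine dvd_add (key _ _ ?_ h) (dvd_mul_of_dvd_left ih _)
      exact hx.trans (dvd_pow_self x (by omega))
  obtain ⟨k, rfl⟩ := Nat.exists_eq_add_of_le' hn
  rw [formalExp, formalExp, coeff_mk, coeff_mk, ← Finset.sum_sub_distrib, Finset.sum_range_succ',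
    Finset.sum_range_succ', Finset.sum_eq_zero]
  · simp
  · intro m _
    rw [← smul_sub, ← map_sub, X_pow_dvd_iff.1 (hpow m) _ (Nat.lt_succ_self _), smul_zero]

theorem formalExp_injective (hx : X ∣ x) (hy : X ∣ y) (h : formalExp x = formalExp y) :
    x = y := by
  ext1 n
  induction n using Nat.strong_induction_on with
  | _ n ih =>
    rcases Nat.eq_zero_or_pos n with rfl | hn
    · have h0 := X_dvd_iff.1 hx
      have h1 := X_dvd_iff.1 hy
      simp [h0, h1]
    · have := coeff_formalExp_sub hn hx hy
        (X_pow_dvd_iff.2 fun i hi => by rw [map_sub, ih i hi, sub_self])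
      rw [h, sub_self] at this
      exact (sub_eq_zero.1 this.symm)

theorem constantCoeff_formalExp (x : (Matrix (Fin N) (Fin N) ℂ)⟦X⟧) :
    constantCoeff (formalExp x) = 1 := by
  rw [← coeff_zero_eq_constantCoeff_apply, formalExp, coeff_mk]
  simp

/-- The coefficients of the formal logarithm of a power series with constant term `1`, found one
after the other. -/
noncomputable def logCoeff (u : (Matrix (Fin N) (Fin N) ℂ)⟦X⟧) : ℕ → Matrix (Fin N) (Fin N) ℂ
  | n => coeff n (u - formalExp (mk fun i => if _h : i < n then logCoeff u i else 0))

theorem logCoeff_zero {u : (Matrix (Fin N) (Fin N) ℂ)⟦X⟧} (hu : constantCoeff u = 1) :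
    logCoeff u 0 = 0 := by
  rw [logCoeff, map_sub, coeff_zero_eq_constantCoeff_apply, coeff_zero_eq_constantCoeff_apply, hu,
    constantCoeff_formalExp, sub_self]

theorem formalExp_logCoeff {u : (Matrix (Fin N) (Fin N) ℂ)⟦X⟧} (hu : constantCoeff u = 1) :
    formalExp (mk (logCoeff u)) = u := by
  ext1 n
  rcases Nat.eq_zero_or_pos n with rfl | hn
  · simp [constantCoeff_formalExp, hu]
  · set y : (Matrix (Fin N) (Fin N) ℂ)⟦X⟧ :=
      mk fun i => if _h : i < n then logCoeff u i else 0 with hy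
    have h := coeff_formalExp_sub (x := mk (logCoeff u)) (y := y) hn
      (X_dvd_iff.2 (by rw [← coeff_zero_eq_constantCoeff_apply, coeff_mk, logCoeff_zero hu]))
      (X_dvd_iff.2 (by rw [← coeff_zero_eq_constantCoeff_apply, hy, coeff_mk, dif_pos hn,
        logCoeff_zero hu]))
      (X_pow_dvd_iff.2 fun i hi => by simp [hy, hi])
    have h2 : logCoeff u n = coeff n u - coeff n (formalExp y) := by
      rw [logCoeff, map_sub]
    have h3 : coeff n y = 0 := by simp [hy]
    rw [coeff_mk, h2, h3, sub_zero] at h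
    exact sub_left_injective h

theorem X_dvd_lieSeries (a : ℕ → uLie N) : X ∣ lieSeries a :=
  X_dvd_iff.2 (by rw [← coeff_zero_eq_constantCoeff_apply]; simp [lieSeries])

theorem star_lieSeries (a : ℕ → uLie N) : star (lieSeries a) = -lieSeries a := by
  ext1 n
  rw [coeff_star, map_neg, lieSeries, coeff_mk]
  split_ifs
  · simp
  · exact (a n).2

theorem formalExp_lieSeries_mem_unitary (a : ℕ → uLie N) :
    formalExp (lieSeries a) ∈ unitary (Matrix (Fin N) (Fin N) ℂ)⟦X⟧ := by
  have h1 := formalExp_mul_neg (X_dvd_lieSeries a)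
  have h2 := formalExp_mul_neg (dvd_neg.2 (X_dvd_lieSeries a))
  rw [neg_neg] at h2
  exact Unitary.mem_iff.2 ⟨by rwa [star_formalExp, star_lieSeries],
    by rwa [star_formalExp, star_lieSeries]⟩

/-- Every unitary power series congruent to `1` modulo `X` is the exponential of a series of
skew-Hermitian matrices: its logarithm is skew because `exp (-x) = (exp x)⁻¹ = exp (star x)` and
the exponential is injective. -/
theorem exists_formalExp_eq {u : unitary (Matrix (Fin N) (Fin N) ℂ)⟦X⟧}
    (hu : u ∈ congruenceSubgroup (Matrix (Fin N) (Fin N) ℂ) 1) :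
    ∃ a : ℕ → uLie N, formalExp (lieSeries a) = u := by
  have hu0 : constantCoeff (u : (Matrix (Fin N) (Fin N) ℂ)⟦X⟧) = 1 := by
    have := X_dvd_iff.1 ((pow_one X).symm.dvd.trans (mem_congruenceSubgroup.1 hu))
    simpa [sub_eq_zero] using this
  set x : (Matrix (Fin N) (Fin N) ℂ)⟦X⟧ := mk (logCoeff u) with hx
  have hX : X ∣ x :=
    X_dvd_iff.2 (by rw [← coeff_zero_eq_constantCoeff_apply, hx, coeff_mk, logCoeff_zero hu0])
  have hexp : formalExp x = u := formalExp_logCoeff hu0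
  have hXs : X ∣ star x := by
    rw [X_dvd_iff] at hX ⊢
    rw [constantCoeff_star, hX, star_zero]
  have hskew : star x = -x := by
    refine formalExp_injective hXs (dvd_neg.2 hX) ?_
    rw [← star_formalExp, hexp]
    have h1 := Unitary.star_mul_self_of_mem u.2
    have h2 := formalExp_mul_neg hX
    rw [hexp] at h2
    exact left_inv_eq_right_inv h1 h2
  have hmem : ∀ n, logCoeff u n ∈ uLie N := fun n => by
    have := congrArg (coeff n) hskew
    rw [coeff_star, map_neg, hx, coeff_mk] at this
    exact this
  refine ⟨fun n => ⟨logCoeff u n, hmem n⟩, ?_⟩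
  refine Eq.trans ?_ hexp
  congr 1
  ext1 n
  rw [lieSeries, coeff_mk, hx, coeff_mk]
  split_ifs with h
  · rw [h, logCoeff_zero hu0]
  · rfl

theorem coeff_one_formalExp_lieSeries (a : ℕ → uLie N) :
    coeff 1 (formalExp (lieSeries a)) = (a 1 : Matrix (Fin N) (Fin N) ℂ) := by
  simp [formalExp, Finset.sum_range_succ, coeff_one, lieSeries]

/-- Every skew-Hermitian matrix is the leading coefficient of a unitary power series in each
positive degree, namely of `exp (x X ^ m)`. -/
theorem exists_hasLeadingTerm {m : ℕ} (hm : 1 ≤ m) (x : uLie N) :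
    ∃ u : unitary (Matrix (Fin N) (Fin N) ℂ)⟦X⟧,
      HasLeadingTerm m u (x : Matrix (Fin N) (Fin N) ℂ) := by
  set y := lieSeries (Pi.single m x) with hy
  refine ⟨⟨_, formalExp_lieSeries_mem_unitary (Pi.single m x)⟩, ?_⟩
  have hdvd : X ^ m ∣ y := X_pow_dvd_iff.2 fun i hi => by
    rw [hy, lieSeries, coeff_mk, Pi.single_eq_of_ne hi.ne]
    simp
  have h1 : X ^ m ∣ formalExp y - 1 := by
    refine X_pow_dvd_iff.2 fun n hn => ?_
    rw [map_sub, formalExp, coeff_mk, Finset.sum_eq_single 0 _ (by simp)]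
    · simp
    · intro k _ hk
      rw [X_pow_dvd_iff.1 (hdvd.trans (dvd_pow_self y hk)) n hn, smul_zero]
  obtain ⟨q, hq⟩ := h1
  refine ⟨q, by rw [← hq, add_sub_cancel], ?_⟩
  have h2 := congrArg (coeff m) hq
  have h3 := coeff_formalExp_sub (x := y) (y := 0) hm (X_dvd_lieSeries _) (dvd_zero _)
    (by rwa [sub_zero])
  have h0 : m ≠ 0 := by omega
  have h4 : coeff m (formalExp (0 : (Matrix (Fin N) (Fin N) ℂ)⟦X⟧)) = 0 := by
    rw [formalExp, coeff_mk, Finset.sum_eq_zero]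
    intro k _
    rcases k with _ | k <;> simp [coeff_one, h0]
  rw [h4, sub_zero, map_zero, sub_zero] at h3
  rw [map_sub, h3, coeff_X_pow_mul', if_pos le_rfl, hy, lieSeries, coeff_mk, if_neg h0,
    Pi.single_eq_same, coeff_one, if_neg h0] at h2
  simpa using h2.symm

end Exp

end FormalDeformations

namespace FormalDeformations

open PowerSeries

/-! ### Relative cocycles in terms of the adjoint action -/

section Cohomology

variable {π : Type} [Group π] {N r : ℕ} {ρ₀ : π →* Matrix.unitaryGroup (Fin N) ℂ}
  {Γ : Fin r → Subgroup π}

/-- Vanishing of the second relative cohomology, spelled out: a pair `(o, -e)` that is a relative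
`2`-cocycle is the relative coboundary of some `(h, c)`. -/
theorem exists_relative_primitive
    (hH2 : Subsingleton (RelativeCohomology.H2 (adRep ρ₀) Γ))
    (o : π → π → uLie N) (e : ∀ j, Γ j → uLie N)
    (ho : ∀ g₁ g₂ g₃, Ad N (ρ₀ g₁) (o g₂ g₃) + o g₁ (g₂ * g₃) = o g₁ g₂ + o (g₁ * g₂) g₃)
    (he : ∀ j (s₁ s₂ : Γ j),
      e j s₁ + Ad N (ρ₀ s₁) (e j s₂) = o s₁ s₂ + e j (s₁ * s₂)) :
    ∃ (h : π → uLie N) (c : Fin r → uLie N),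
      (∀ g₁ g₂, h g₁ + Ad N (ρ₀ g₁) (h g₂) + o g₁ g₂ - h (g₁ * g₂) = 0) ∧
      ∀ j (s : Γ j), h s + e j s + Ad N (ρ₀ s) (c j) - c j = 0 := by
  let y : RelativeCohomology.C2 (adRep ρ₀) Γ := (fun g => o g.1 g.2, fun j s => -e j s)
  have hy : y ∈ LinearMap.ker (RelativeCohomology.d23 (adRep ρ₀) Γ) := by
    rw [LinearMap.mem_ker, RelativeCohomology.d23_apply]
    refine Prod.ext (funext fun g => ?_) (funext fun j => funext fun s => ?_)
    · change -(Ad N (ρ₀ g.1) (o g.2.1 g.2.2) - o (g.1 * g.2.1) g.2.2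
        + o g.1 (g.2.1 * g.2.2) - o g.1 g.2.1) = (0 : uLie N)
      have := ho g.1 g.2.1 g.2.2
      rw [← sub_eq_zero] at this
      rw [neg_eq_zero, ← this]
      abel
    · change o s.1 s.2 + (Ad N (ρ₀ s.1) (-e j s.2) - -e j (s.1 * s.2) + -e j s.1) = (0 : uLie N)
      have := he j s.1 s.2
      rw [← sub_eq_zero] at this
      rw [map_neg, ← neg_eq_zero, ← this]
      abel
  have h0 := Subsingleton.elim
    (Submodule.Quotient.mk ⟨y, hy⟩ : RelativeCohomology.H2 (adRep ρ₀) Γ) 0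
  rw [Submodule.Quotient.mk_eq_zero] at h0
  obtain ⟨x, hx⟩ : y ∈ LinearMap.range (RelativeCohomology.d12 (adRep ρ₀) Γ) := h0
  rw [RelativeCohomology.d12_apply] at hx
  refine ⟨x.1, x.2, fun g₁ g₂ => ?_, fun j s => ?_⟩
  · have h1 : -(Ad N (ρ₀ g₁) (x.1 g₂) - x.1 (g₁ * g₂) + x.1 g₁) = o g₁ g₂ :=
      congrFun (congrArg Prod.fst hx) (g₁, g₂)
    rw [← h1]
    abel
  · have h1 : x.1 s + (Ad N (ρ₀ s) (x.2 j) - x.2 j) = -e j s :=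
      congrFun (congrFun (congrArg Prod.snd hx) j) s
    rw [eq_neg_iff_add_eq_zero] at h1
    rw [← h1]
    abel

/-- A class of `H¹` whose restrictions to the `Γⱼ` vanish is represented by a cocycle whose
restriction to each `Γⱼ` is the coboundary of some `cⱼ`. -/
theorem exists_cocycle_of_mem_parabolicH1 {η : groupCohomology.H1 (adRep ρ₀)}
    (hη : η ∈ RelativeCohomology.parabolicH1 (adRep ρ₀) Γ) :
    ∃ (z : groupCohomology.cocycles₁ (adRep ρ₀)) (c : Fin r → uLie N),
      groupCohomology.H1π (adRep ρ₀) z = η ∧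
      ∀ j (s : Γ j), Ad N (ρ₀ s) (c j) - c j = z (s : π) := by
  induction η using groupCohomology.H1_induction_on with
  | h z =>
    have hj : ∀ j, ∃ c : uLie N, ∀ s : Γ j, Ad N (ρ₀ s) c - c = z (s : π) := by
      intro j
      have h1 := (Submodule.mem_iInf _).1 hη j
      rw [LinearMap.mem_ker] at h1
      erw [groupCohomology.H1π_comp_map_apply] at h1
      obtain ⟨c, hc⟩ := (groupCohomology.H1π_eq_zero_iff _).1 h1
      exact ⟨c, fun s => congrFun hc s⟩
    choose c hc using hj
    exact ⟨z, c, rfl, hc⟩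

end Cohomology

/-! ### The obstruction to extending a deformation by one order -/

section Obstruction

variable {π : Type} [Group π] {N r : ℕ}

/-- The group of unitary matrix power series. -/
abbrev UnitarySeries (N : ℕ) : Type := unitary (Matrix (Fin N) (Fin N) ℂ)⟦X⟧

theorem HasLeadingTerm.exists_uLie {m : ℕ} (hm : 1 ≤ m) {u : UnitarySeries N}
    (hu : u ∈ congruenceSubgroup (Matrix (Fin N) (Fin N) ℂ) m) :
    ∃ x : uLie N, HasLeadingTerm m u (x : Matrix (Fin N) (Fin N) ℂ) := by
  obtain ⟨a, ha⟩ := HasLeadingTerm.exists_of_mem hu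
  exact ⟨⟨a, ha.star_eq_neg hm⟩, ha⟩

theorem HasLeadingTerm.conj_Ad {m : ℕ} {u e : UnitarySeries N} {x : uLie N}
    (hu : HasLeadingTerm m u (x : Matrix (Fin N) (Fin N) ℂ)) {a : Matrix.unitaryGroup (Fin N) ℂ}
    (he : constantCoeff (e : (Matrix (Fin N) (Fin N) ℂ)⟦X⟧) = a) :
    HasLeadingTerm m (e * u * e⁻¹) (Ad N a x : Matrix (Fin N) (Fin N) ℂ) := by
  have := hu.conj e
  rw [he] at this
  exact this

/-- The failure of `ρ` to be multiplicative. -/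
noncomputable def defect (ρ : π → UnitarySeries N) (g₁ g₂ : π) : UnitarySeries N :=
  ρ g₁ * ρ g₂ * (ρ (g₁ * g₂))⁻¹

/-- The failure of `ρ` to be the conjugate of the constant `ρ₀` by `K`. -/
noncomputable def conjDefect (ρ₀ : π →* Matrix.unitaryGroup (Fin N) ℂ) (ρ : π → UnitarySeries N)
    (K : UnitarySeries N) (g : π) : UnitarySeries N :=
  ρ g * (K * constUnitary _ (ρ₀ g) * K⁻¹)⁻¹

/-- Modulo `X ^ m`, the map `ρ` is a homomorphism which on each `Γⱼ` is the conjugate of `ρ₀` by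
`Kⱼ`; moreover `ρ` lifts `ρ₀` and `Kⱼ` lifts `1`. -/
structure IsDeformationMod (ρ₀ : π →* Matrix.unitaryGroup (Fin N) ℂ) (Γ : Fin r → Subgroup π)
    (m : ℕ) (ρ : π → UnitarySeries N) (K : Fin r → UnitarySeries N) : Prop where
  lift : ∀ g, ρ g * (constUnitary _ (ρ₀ g))⁻¹ ∈ congruenceSubgroup _ 1
  lift_conj : ∀ j, K j ∈ congruenceSubgroup _ 1
  defect_mem : ∀ g₁ g₂, defect ρ g₁ g₂ ∈ congruenceSubgroup _ m
  conjDefect_mem : ∀ j (s : Γ j), conjDefect ρ₀ ρ (K j) s ∈ congruenceSubgroup _ m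

variable {ρ₀ : π →* Matrix.unitaryGroup (Fin N) ℂ} {Γ : Fin r → Subgroup π}
  {m : ℕ} {ρ : π → UnitarySeries N} {K : Fin r → UnitarySeries N}

namespace IsDeformationMod

theorem constantCoeff_eq (H : IsDeformationMod ρ₀ Γ m ρ K) (g : π) :
    constantCoeff (ρ g : (Matrix (Fin N) (Fin N) ℂ)⟦X⟧) = ρ₀ g := by
  rw [constantCoeff_eq_of_mul_inv_mem le_rfl (H.lift g), coe_constUnitary, constantCoeff_C]

theorem constantCoeff_conj_eq (H : IsDeformationMod ρ₀ Γ m ρ K) (j : Fin r) (g : π) :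
    constantCoeff ((K j * constUnitary _ (ρ₀ g) * (K j)⁻¹ : UnitarySeries N) :
      (Matrix (Fin N) (Fin N) ℂ)⟦X⟧) = ρ₀ g := by
  rw [constantCoeff_eq_of_mul_inv_mem le_rfl (v := constUnitary _ (ρ₀ g)), coe_constUnitary,
    constantCoeff_C]
  have h := (congruenceSubgroup _ 1).mul_mem (H.lift_conj j)
    ((inferInstance : (congruenceSubgroup _ 1).Normal).conj_mem _
      ((congruenceSubgroup _ 1).inv_mem (H.lift_conj j)) (constUnitary _ (ρ₀ g)))
  convert h using 1
  group

/-- Multiplying `ρ` and `Kⱼ` by `1 + h X ^ m + ⋯` and `1 + cⱼ X ^ m + ⋯` changes the leading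
coefficients `o` and `e` of the two defects by `∂h` and `h + ∂cⱼ`. If the result vanishes, a
deformation modulo `X ^ (m + 1)` is obtained. -/
theorem exists_update (hm : 1 ≤ m) (H : IsDeformationMod ρ₀ Γ m ρ K)
    {o : π → π → uLie N} (ho : ∀ g₁ g₂, HasLeadingTerm m (defect ρ g₁ g₂) (o g₁ g₂ : Matrix _ _ ℂ))
    {e : ∀ j, Γ j → uLie N}
    (he : ∀ j (s : Γ j), HasLeadingTerm m (conjDefect ρ₀ ρ (K j) s) (e j s : Matrix _ _ ℂ))
    {h : π → uLie N} {c : Fin r → uLie N}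
    (hh : ∀ g₁ g₂, h g₁ + Ad N (ρ₀ g₁) (h g₂) + o g₁ g₂ - h (g₁ * g₂) = 0)
    (hc : ∀ j (s : Γ j), h s + e j s + Ad N (ρ₀ s) (c j) - c j = 0) :
    ∃ ρ' K', IsDeformationMod ρ₀ Γ (m + 1) ρ' K' ∧
      (∀ g, HasLeadingTerm m (ρ' g * (ρ g)⁻¹) (h g : Matrix _ _ ℂ)) ∧
      ∀ j, K' j * (K j)⁻¹ ∈ congruenceSubgroup _ m := by
  choose φ hφ using fun g => exists_hasLeadingTerm hm (h g)
  choose κ hκ using fun j => exists_hasLeadingTerm hm (c j)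
  refine ⟨fun g => φ g * ρ g, fun j => κ j * K j, ⟨fun g => ?_, fun j => ?_, fun g₁ g₂ => ?_,
    fun j s => ?_⟩, fun g => ?_, fun j => ?_⟩
  · rw [mul_assoc]
    exact mul_mem (congruenceSubgroup_anti hm (hφ g).mem) (H.lift g)
  · exact mul_mem (congruenceSubgroup_anti hm (hκ j).mem) (H.lift_conj j)
  · have h1 := ((((hφ g₁).mul hm ((hφ g₂).conj_Ad (H.constantCoeff_eq g₁))).mul hm
      (ho g₁ g₂)).mul hm ((hφ (g₁ * g₂)).inv hm))
    have h2 := congrArg (Subtype.val) (hh g₁ g₂)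
    rw [sub_eq_add_neg] at h2
    rw [← HasLeadingTerm.zero_iff]
    convert h1 using 1
    · simp only [defect]
      group
    · exact h2.symm
  · have h1 := ((((hφ s).mul hm (he j s)).mul hm
      ((hκ j).conj_Ad (H.constantCoeff_conj_eq j s))).mul hm ((hκ j).inv hm))
    have h2 := congrArg (Subtype.val) (hc j s)
    rw [sub_eq_add_neg] at h2
    rw [← HasLeadingTerm.zero_iff]
    convert h1 using 1
    · simp only [conjDefect]
      group
    · exact h2.symm
  · simpa using hφ g
  · simpa using (hκ j).mem

/-- The leading coefficients of the two defects of a deformation modulo `X ^ m` form a relative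
`2`-cocycle, by associativity; so when the relative `H²` vanishes, the deformation extends to the
next order. -/
theorem exists_next (hH2 : Subsingleton (RelativeCohomology.H2 (adRep ρ₀) Γ)) (hm : 1 ≤ m)
    (H : IsDeformationMod ρ₀ Γ m ρ K) :
    ∃ ρ' K', IsDeformationMod ρ₀ Γ (m + 1) ρ' K' ∧
      (∀ g, ρ' g * (ρ g)⁻¹ ∈ congruenceSubgroup _ m) ∧
      ∀ j, K' j * (K j)⁻¹ ∈ congruenceSubgroup _ m := by
  choose o ho using fun g₁ g₂ => HasLeadingTerm.exists_uLie hm (H.defect_mem g₁ g₂)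
  choose e he using fun j s => HasLeadingTerm.exists_uLie hm (H.conjDefect_mem j s)
  obtain ⟨h, c, hh, hc⟩ := exists_relative_primitive hH2 o e
    (fun g₁ g₂ g₃ => by
      have h1 := ((ho g₂ g₃).conj_Ad (H.constantCoeff_eq g₁)).mul hm (ho g₁ (g₂ * g₃))
      have h2 := (ho g₁ g₂).mul hm (ho (g₁ * g₂) g₃)
      have h3 : ρ g₁ * defect ρ g₂ g₃ * (ρ g₁)⁻¹ * defect ρ g₁ (g₂ * g₃) =
          defect ρ g₁ g₂ * defect ρ (g₁ * g₂) g₃ := by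
        simp only [defect, mul_assoc g₁ g₂ g₃]
        group
      rw [h3] at h1
      exact Subtype.ext (h1.unique h2))
    (fun j s₁ s₂ => by
      have h1 := (he j s₁).mul hm ((he j s₂).conj_Ad (H.constantCoeff_conj_eq j s₁))
      have h2 := (ho s₁ s₂).mul hm (he j (s₁ * s₂))
      have h3 : conjDefect ρ₀ ρ (K j) s₁ * (K j * constUnitary _ (ρ₀ s₁) * (K j)⁻¹ *
          conjDefect ρ₀ ρ (K j) s₂ * (K j * constUnitary _ (ρ₀ s₁) * (K j)⁻¹)⁻¹) =
          defect ρ s₁ s₂ * conjDefect ρ₀ ρ (K j) (s₁ * s₂) := by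
        simp only [defect, conjDefect, map_mul]
        group
      rw [h3] at h1
      exact Subtype.ext (h1.unique h2))
  obtain ⟨ρ', K', H', h1, h2⟩ := H.exists_update hm ho he hh hc
  exact ⟨ρ', K', H', fun g => (h1 g).mem, h2⟩

/-- A deformation modulo `X ^ m` extends to all orders when the relative `H²` vanishes. -/
theorem exists_lift (hH2 : Subsingleton (RelativeCohomology.H2 (adRep ρ₀) Γ)) (hm : 1 ≤ m)
    (H : IsDeformationMod ρ₀ Γ m ρ K) :
    ∃ (P : π →* UnitarySeries N) (L : Fin r → UnitarySeries N),
      (∀ g, P g * (ρ g)⁻¹ ∈ congruenceSubgroup _ m) ∧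
      (∀ j, L j ∈ congruenceSubgroup _ 1) ∧
      ∀ j (s : Γ j), P s = L j * constUnitary _ (ρ₀ s) * (L j)⁻¹ := by
  let State (n : ℕ) : Type :=
    {x : (π → UnitarySeries N) × (Fin r → UnitarySeries N) // IsDeformationMod ρ₀ Γ (m + n) x.1 x.2}
  have next : ∀ n (x : State n), ∃ y : State (n + 1),
      (∀ g, y.1.1 g * (x.1.1 g)⁻¹ ∈ congruenceSubgroup _ (m + n)) ∧
      ∀ j, y.1.2 j * (x.1.2 j)⁻¹ ∈ congruenceSubgroup _ (m + n) := by
    intro n x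
    obtain ⟨ρ', K', H', h1, h2⟩ := x.2.exists_next hH2 (hm.trans (Nat.le_add_right m n))
    exact ⟨⟨(ρ', K'), H'⟩, h1, h2⟩
  choose F hF hF' using next
  let x : ∀ n, State n := fun n => Nat.rec ⟨(ρ, K), H⟩ F n
  have hx : ∀ n g, (x (n + 1)).1.1 g * ((x n).1.1 g)⁻¹ ∈ congruenceSubgroup _ (m + n) :=
    fun n => hF n (x n)
  have hx' : ∀ n j, (x (n + 1)).1.2 j * ((x n).1.2 j)⁻¹ ∈ congruenceSubgroup _ (m + n) :=
    fun n => hF' n (x n)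
  choose P hP using fun g => exists_limit m (fun n => (x n).1.1 g) fun n => hx n g
  choose L hL using fun j => exists_limit m (fun n => (x n).1.2 j) fun n => hx' n j
  have hmul : ∀ g₁ g₂, P (g₁ * g₂) = P g₁ * P g₂ := by
    refine fun g₁ g₂ => (eq_of_forall_mul_inv_mem fun n => ?_).symm
    refine congruenceSubgroup_anti (Nat.le_add_left n m) ?_
    have h := (x n).2.defect_mem g₁ g₂
    have h1 := hP g₁ n
    have h2 := hP g₂ n
    have h3 := hP (g₁ * g₂) n
    rw [defect] at h
    rw [← div_eq_mul_inv, ← QuotientGroup.eq_iff_div_mem] at h h1 h2 h3 ⊢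
    rw [QuotientGroup.mk_mul] at h ⊢
    rw [h1, h2, h3, h]
  have hconj : ∀ j (s : Γ j), P s = L j * constUnitary _ (ρ₀ s) * (L j)⁻¹ := by
    refine fun j s => eq_of_forall_mul_inv_mem fun n => ?_
    refine congruenceSubgroup_anti (Nat.le_add_left n m) ?_
    have h := (x n).2.conjDefect_mem j s
    have h1 := hP s n
    have h2 := hL j n
    rw [conjDefect] at h
    rw [← div_eq_mul_inv, ← QuotientGroup.eq_iff_div_mem] at h h1 h2 ⊢
    rw [QuotientGroup.mk_mul, QuotientGroup.mk_mul, QuotientGroup.mk_inv] at h ⊢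
    rw [h1, h2, h]
  refine ⟨MonoidHom.mk' P hmul, L, fun g => hP g 0, fun j => ?_, hconj⟩
  have h1 : L j * (K j)⁻¹ ∈ congruenceSubgroup _ 1 := congruenceSubgroup_anti hm (hL j 0)
  have h2 := mul_mem h1 (H.lift_conj j)
  rwa [inv_mul_cancel_right] at h2

/-- A class of `H¹` whose restrictions to the `Γⱼ` vanish gives a deformation modulo `X ^ 2`. -/
theorem exists_first_order {z : π → uLie N} {c : Fin r → uLie N}
    (hz : ∀ g₁ g₂, z (g₁ * g₂) = z g₁ + Ad N (ρ₀ g₁) (z g₂))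
    (hc : ∀ j (s : Γ j), Ad N (ρ₀ s) (c j) - c j = z s) :
    ∃ ρ K, IsDeformationMod ρ₀ Γ 2 ρ K ∧
      ∀ g, HasLeadingTerm 1 (ρ g * (constUnitary _ (ρ₀ g))⁻¹) (-z g : Matrix _ _ ℂ) := by
  have hd : ∀ g₁ g₂, defect (fun g => constUnitary _ (ρ₀ g)) g₁ g₂ = 1 := fun g₁ g₂ => by
    simp [defect]
  have hd' : ∀ g, conjDefect ρ₀ (fun g => constUnitary _ (ρ₀ g)) 1 g = 1 := fun g => by
    simp [conjDefect]
  have H : IsDeformationMod ρ₀ Γ 1 (fun g => constUnitary _ (ρ₀ g)) (fun _ => 1) :=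
    { lift := fun g => by simp
      lift_conj := fun j => one_mem _
      defect_mem := fun g₁ g₂ => by rw [hd]; exact one_mem _
      conjDefect_mem := fun j s => by rw [hd']; exact one_mem _ }
  obtain ⟨ρ, K, h1, h2, -⟩ := H.exists_update (o := fun _ _ => 0) (e := fun _ _ => 0)
    (h := fun g => -z g) (c := c) le_rfl
    (fun g₁ g₂ => by rw [hd]; exact HasLeadingTerm.one)
    (fun j s => by rw [hd']; exact HasLeadingTerm.one)
    (fun g₁ g₂ => by rw [hz, map_neg]; abel)
    (fun j s => by rw [← hc]; abel)
  exact ⟨ρ, K, h1, h2⟩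

end IsDeformationMod

end Obstruction

end FormalDeformations

/-! ### Existence of the formal deformation -/

open FormalDeformations PowerSeries

theorem proposition3p1 {π : Type} [Group π] [Group.FG π] (N r : ℕ) (γ : Fin r → π)
    (ρ₀ : π →* Matrix.unitaryGroup (Fin N) ℂ)
    (hH2 : Subsingleton (RelativeCohomology.H2 (FormalDeformations.adRep ρ₀)
      (fun j => Subgroup.zpowers (γ j))))
    (η : groupCohomology.H1 (FormalDeformations.adRep ρ₀))
    (hη : η ∈ RelativeCohomology.parabolicH1 (FormalDeformations.adRep ρ₀)
      (fun j => Subgroup.zpowers (γ j))) :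
    ∃ ρt : FormalDeformations.FormalDeformation ρ₀,
      (∀ j, ρt.FixesConjClass (γ j)) ∧ ρt.Represents η := by
  obtain ⟨z, c, hzη, hzc⟩ := exists_cocycle_of_mem_parabolicH1 hη
  have hz : ∀ g₁ g₂, (z (g₁ * g₂) : uLie N) = z g₁ + Ad N (ρ₀ g₁) (z g₂) := fun g₁ g₂ =>
    ((groupCohomology.mem_cocycles₁_iff z).1 z.2 g₁ g₂).trans (add_comm _ _)
  obtain ⟨ρ, K, H, hρ⟩ := IsDeformationMod.exists_first_order (z := fun g => z g) hz hzc
  obtain ⟨P, L, hP, hL, hPL⟩ := H.exists_lift hH2 one_le_two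
  have hlead : ∀ g, HasLeadingTerm 1 (P g * (constUnitary _ (ρ₀ g))⁻¹)
      (-(z g : uLie N) : Matrix (Fin N) (Fin N) ℂ) := fun g => by
    have := (HasLeadingTerm.zero_iff.2 (hP g)).mul le_rfl (hρ g)
    rwa [zero_add, mul_assoc, inv_mul_cancel_left] at this
  -- The exponential stands to the right of `ρ₀ g`, whereas `hlead` concerns a factor on the left;
  -- normality of the congruence subgroup passes from one side to the other.
  have hleft : ∀ g, (constUnitary _ (ρ₀ g))⁻¹ * P g ∈ congruenceSubgroup _ 1 := fun g => by
    have := (inferInstance : (congruenceSubgroup _ 1).Normal).conj_mem _ (hlead g).mem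
      (constUnitary _ (ρ₀ g))⁻¹
    simpa [mul_assoc] using this
  choose f hf using fun g => exists_formalExp_eq (hleft g)
  choose b hb using fun j => exists_formalExp_eq (hL j)
  have hinv : ∀ j, formalExp (-lieSeries (b j)) = ((L j)⁻¹ : UnitarySeries N) := fun j => by
    change _ = star (L j : (Matrix (Fin N) (Fin N) ℂ)⟦X⟧)
    rw [← hb, star_formalExp, star_lieSeries]
  let ρt : FormalDeformation ρ₀ :=
    { toHom := (unitary _).subtype.comp P
      f := fun i g => f g i
      toHom_eq := fun g => by
        change (P g : (Matrix (Fin N) (Fin N) ℂ)⟦X⟧) = C _ * formalExp (lieSeries (f g))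
        rw [hf, ← coe_constUnitary, ← Submonoid.coe_mul, mul_inv_cancel_left] }
  refine ⟨ρt, fun j => ⟨b j, ?_⟩, z, fun g => ?_, hzη⟩
  · change (P (γ j) : (Matrix (Fin N) (Fin N) ℂ)⟦X⟧) = _
    rw [hPL j ⟨γ j, Subgroup.mem_zpowers _⟩, hb, hinv]
    rfl
  · -- `ρ₀ g * P g⁻¹` is the inverse of `P g * (ρ₀ g)⁻¹`, whose leading coefficient is `-z g`.
    have h1 := (hlead g).inv le_rfl
    have h2 : (P g * (constUnitary _ (ρ₀ g))⁻¹)⁻¹ = (constUnitary _ (ρ₀ g⁻¹))⁻¹ * P g⁻¹ := by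
      simp
    rw [neg_neg, h2] at h1
    have h3 := h1.coeff_eq le_rfl
    rw [← hf, coeff_one_formalExp_lieSeries] at h3
    exact Subtype.ext h3.symm
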